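/- Let $d\in\mathbb{N}$ and let $f_1,f_2,\ldots$ be upper semi-continuous, log-concave probability densities with respect to Lebesgue measure on $\mathbb{R}^d$ (that is, $f_n=e^{\phi_n}$ with $\phi_n:\mathbb{R}^d\to[-\infty,\infty)$ concave and upper semi-continuous). Let $\nu_n$ be the probability measure on $\mathbb{R}^d$ with density $f_n$, and suppose that $\nu_n$ converges weakly to a probability measure $\nu$ on $\mathbb{R}^d$ (which may be singular with respect to Lebesgue measure). Let $\mathrm{csupp}(\nu)$ be the smallest closed convex subset of $\mathbb{R}^d$ of $\nu$-measure $1$, let $U$ be the unique linear subspace of $\mathbb{R}^d$ such that the affine hull of $\mathrm{csupp}(\nu)$ equals $U+a$ for some $a\in\mathbb{R}^d$, and let $U^\perp$ be its orthogonal complement. Let \[ \Theta=\Bigl\{\theta\in\mathbb{R}^d:\int_{\mathbb{R}^d}e^{\theta^Tx}\,d\nu(x)<\infty\Bigr\}. \] Then $\Theta=\Theta_0\oplus U^\perp=\{\theta_0+\theta_1:\theta_0\in\Theta_0,\ \theta_1\in U^\perp\}$ for some set $\Theta_0\subseteq U$ that is relatively open in $U$, convex, and contains $0$. Moreover, for every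 $\theta\in\Theta$, \[ \int_{\mathbb{R}^d}e^{\theta^Tx}\,d\nu_n(x)\to\int_{\mathbb{R}^d}e^{\theta^Tx}\,d\nu(x)\qquad(n\to\infty), \] where the integrals on the left are elements of $[0,\infty]$. In particular, $\nu$ and every $\nu_n$ have finite second moments, and the covariance matrix of $\nu_n$ converges to the covariance matrix of $\nu$. -/

import Mathlib

open MeasureTheory ProbabilityTheory Filter Topology
open scoped ENNReal Pointwise

noncomputable section

/-- `f` is an upper semi-continuous, log-concave probability density with respect to Lebesgue
measure on `ℝ^d`. Log-concavity of `f ≥ 0` is `f(x)^a f(y)^b ≤ f(a x + b y)` for `a, b > 0`,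
`a + b = 1`, i.e. concavity of `log f`, with values in `[-∞, ∞)`; `f` may vanish. -/
structure IsLogConcaveDensity {d : ℕ} (f : EuclideanSpace ℝ (Fin d) → ℝ) : Prop where
  nonneg : ∀ x, 0 ≤ f x
  upperSemicontinuous : UpperSemicontinuous f
  logConcave : ∀ x y : EuclideanSpace ℝ (Fin d), ∀ a b : ℝ, 0 < a → 0 < b → a + b = 1 →
    f x ^ a * f y ^ b ≤ f (a • x + b • y)
  lintegral_eq_one : ∫⁻ x, ENNReal.ofReal (f x) = 1

/-- The convex support of a probability measure: the smallest closed convex set of measure `1`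
(see `isLeast_convexSupport`). -/
def convexSupport {d : ℕ} (ν : Measure (EuclideanSpace ℝ (Fin d))) :
    Set (EuclideanSpace ℝ (Fin d)) :=
  ⋂₀ {K | IsClosed K ∧ Convex ℝ K ∧ ν K = 1}

theorem isLeast_convexSupport {d : ℕ} (ν : Measure (EuclideanSpace ℝ (Fin d)))
    [IsProbabilityMeasure ν] :
    IsLeast {K | IsClosed K ∧ Convex ℝ K ∧ ν K = 1} (convexSupport ν) := by
  refine ⟨⟨isClosed_sInter fun K hK => hK.1, convex_sInter fun K hK => hK.2.1, ?_⟩,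
    fun K hK => Set.sInter_subset_of_mem hK⟩
  have hcl : IsClosed (convexSupport ν) := isClosed_sInter fun K hK => hK.1
  refine (prob_compl_eq_zero_iff hcl.measurableSet).1 ?_
  obtain ⟨T, hTc, hTS, hTU⟩ := TopologicalSpace.isOpen_sUnion_countable
    (compl '' {K : Set (EuclideanSpace ℝ (Fin d)) | IsClosed K ∧ Convex ℝ K ∧ ν K = 1})
    (by rintro _ ⟨K, hK, rfl⟩; exact hK.1.isOpen_compl)
  rw [convexSupport, Set.compl_sInter, ← hTU, measure_sUnion_null_iff hTc]
  intro s hs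
  obtain ⟨K, hK, rfl⟩ := hTS hs
  exact (prob_compl_eq_zero_iff hK.1.measurableSet).2 hK.2.2

/-- The unique linear subspace `U` such that the affine hull of the convex support of `ν` is
`U + a` for some point `a`. -/
def supportDirection {d : ℕ} (ν : Measure (EuclideanSpace ℝ (Fin d))) :
    Submodule ℝ (EuclideanSpace ℝ (Fin d)) :=
  (affineSpan ℝ (convexSupport ν)).direction

/-- The exponential moment `∫ exp(θᵀ x) dν(x)`, with values in `[0, ∞]`. -/
def expMoment {d : ℕ} (ν : Measure (EuclideanSpace ℝ (Fin d)))
    (θ : EuclideanSpace ℝ (Fin d)) : ℝ≥0∞ :=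
  ∫⁻ x, ENNReal.ofReal (Real.exp (inner ℝ θ x)) ∂ν

/-- The set `Θ` of all `θ` at which `ν` has a finite exponential moment. -/
def expMomentDomain {d : ℕ} (ν : Measure (EuclideanSpace ℝ (Fin d))) :
    Set (EuclideanSpace ℝ (Fin d)) :=
  {θ | expMoment ν θ < ∞}

/-- The covariance matrix of a measure with finite second moments. -/
def covMatrix {d : ℕ} (ν : Measure (EuclideanSpace ℝ (Fin d))) : Matrix (Fin d) (Fin d) ℝ :=
  Matrix.of fun i j => cov[fun x => x i, fun x => x j; ν]

end

/-! The obstacle is that weak convergence controls only bounded continuous functions, while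
`exp(θᵀx)` is unbounded. Log-concavity supplies the missing uniform tail bound. Multiplying a
log-concave density by `exp(θᵀx)` keeps it log-concave, so by the Prékopa-Leindler inequality every
tilt of `ν_n` satisfies `μ(A) μ(B) ≤ μ(C)²` when `C` contains the midpoints of `A` and `B`
(`IsMidpointLogConcave`). Only this midpoint inequality is used afterwards.

With `A` a ball of mass at least `c` and `B` a dyadic shell, the ratio of shell mass to `c` is at
most squared from one shell to the next. A small first shell thus forces exponentially small tails
(`IsMidpointLogConcave.setLIntegral_exp_norm_le`). For `θ ∈ Θ`, weak convergence tested on compactly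
supported functions gives both inputs for all large `n`, with the same constants.

Uniform tails yield `tendsto_expMoment`, and, since they leave room for an extra factor `exp(ε‖x‖)`,
also openness of `Θ` (`isOpen_expMomentDomain`). The splitting along `U ⊕ Uᗮ` holds because `uᵀx` is
`ν`-a.e. constant for `u ∈ Uᗮ`. As `0` is interior to `Θ`, quadratic functions are dominated by
finitely many exponentials whose integrals converge, which gives the covariances. -/

/-! ### The Prékopa-Leindler inequality for midpoints -/

/-- The one-dimensional Brunn-Minkowski inequality for midpoints of compact sets. -/
theorem IsCompact.volume_add_volume_le_two_mul {A B C : Set ℝ} (hA : IsCompact A)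
    (hB : IsCompact B) (hA0 : A.Nonempty) (hB0 : B.Nonempty)
    (h : ∀ x ∈ A, ∀ y ∈ B, (1 / 2 : ℝ) * (x + y) ∈ C) :
    volume A + volume B ≤ 2 * volume C := by
  obtain ⟨α, hαA, hα⟩ := hA.exists_isGreatest hA0
  obtain ⟨β, hβB, hβ⟩ := hB.exists_isLeast hB0
  -- These are `A + min B` and `B + max A`: both lie in `2C`, on opposite sides of `α + β`, so they
  -- overlap in at most one point.
  set A' : Set ℝ := (fun z => z + -β) ⁻¹' A with hA'
  set B' : Set ℝ := (fun z => z + -α) ⁻¹' B with hB'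
  have e1 : volume A' = volume A := measure_preimage_add_right _ _ _
  have e2 : volume B' = volume B := measure_preimage_add_right _ _ _
  have e3 : volume ((fun z : ℝ => z * (1 / 2)) ⁻¹' C) = 2 * volume C := by
    rw [Real.volume_preimage_mul_right (by norm_num)]
    norm_num
  have hsub : A' ∪ B' ⊆ (fun z : ℝ => z * (1 / 2)) ⁻¹' C := by
    rintro z (hz | hz)
    · have := h _ hz β hβB
      simp only [Set.mem_preimage]
      convert this using 1
      ring
    · have := h α hαA _ hz
      simp only [Set.mem_preimage]
      convert this using 1
      ring
  have hint : A' ∩ B' ⊆ {α + β} := by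
    rintro z ⟨hz1, hz2⟩
    have h1 := hα hz1
    have h2 := hβ hz2
    simp only at h1 h2
    rw [Set.mem_singleton_iff]
    linarith
  have hB'm : MeasurableSet B' := (measurable_id.add_const _) hB.measurableSet
  have h0 : volume (A' ∩ B') = 0 := measure_mono_null hint (by simp)
  rw [← e1, ← e2, ← measure_union_add_inter A' hB'm, h0, add_zero, ← e3]
  exact measure_mono hsub

/-- Inner regularity reduces to compact sets. A null set has no `r` below its volume to approximate,
so a singleton is used there. -/
theorem MeasurableSet.volume_add_volume_le_two_mul {A B C : Set ℝ} (hA : MeasurableSet A)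
    (hB : MeasurableSet B) (hA0 : A.Nonempty) (hB0 : B.Nonempty)
    (h : ∀ x ∈ A, ∀ y ∈ B, (1 / 2 : ℝ) * (x + y) ∈ C) :
    volume A + volume B ≤ 2 * volume C := by
  have key : ∀ S : Set ℝ, MeasurableSet S → S.Nonempty → ∀ r < volume S,
      ∃ K ⊆ S, IsCompact K ∧ K.Nonempty ∧ r < volume K := by
    intro S hS hS0 r hr
    obtain ⟨K, hKS, hK, hrK⟩ := hS.exists_lt_isCompact hr
    refine ⟨K, hKS, hK, ?_, hrK⟩
    by_contra hne
    simp [Set.not_nonempty_iff_eq_empty.1 hne] at hrK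
  have key' : ∀ S : Set ℝ, MeasurableSet S → S.Nonempty → ∀ c : ℝ≥0∞, ∀ D,
      (∀ K ⊆ S, IsCompact K → K.Nonempty → c + volume K ≤ D) → c + volume S ≤ D := by
    intro S hS hS0 c D hD
    rcases eq_or_ne (volume S) 0 with h0 | h0
    · obtain ⟨x, hx⟩ := hS0
      have := hD {x} (by simpa using hx) isCompact_singleton (by simp)
      simpa [h0] using this
    · have hT : Tendsto (fun t : ℝ≥0∞ => c + t) (𝓝[<] volume S) (𝓝 (c + volume S)) :=
        (tendsto_const_nhds.add tendsto_id).mono_left nhdsWithin_le_nhds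
      have : (𝓝[<] volume S).NeBot := nhdsLT_neBot_of_exists_lt ⟨0, pos_iff_ne_zero.2 h0⟩
      refine le_of_tendsto hT ?_
      filter_upwards [self_mem_nhdsWithin] with t ht
      obtain ⟨K, hKS, hK, hK0, hlt⟩ := key S hS hS0 t ht
      exact (add_le_add le_rfl hlt.le).trans (hD K hKS hK hK0)
  refine key' B hB hB0 _ _ fun L hLB hL hL0 => ?_
  rw [add_comm]
  refine key' A hA hA0 _ _ fun K hKA hK hK0 => ?_
  rw [add_comm]
  exact hK.volume_add_volume_le_two_mul hL hK0 hL0 fun x hx y hy => h x (hKA hx) y (hLB hy)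

theorem lintegral_eq_lintegral_measure_ofReal_lt {α : Type*} [MeasurableSpace α] (μ : Measure α)
    {f : α → ℝ≥0∞} (hf : Measurable f) (hfin : ∀ x, f x ≠ ∞) :
    ∫⁻ x, f x ∂μ = ∫⁻ t in Set.Ioi (0 : ℝ), μ {x | ENNReal.ofReal t < f x} := by
  have h := lintegral_eq_lintegral_meas_lt μ (f := fun x => (f x).toReal)
    (ae_of_all _ fun x => ENNReal.toReal_nonneg) hf.ennreal_toReal.aemeasurable
  simp only [ENNReal.ofReal_toReal (hfin _)] at h
  rw [h]
  refine setLIntegral_congr_fun measurableSet_Ioi fun t ht => ?_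
  simp only [ENNReal.ofReal_lt_iff_lt_toReal (le_of_lt ht) (hfin _)]

theorem ENNReal.four_mul_mul_le_add_sq (x y : ℝ≥0∞) : 4 * (x * y) ≤ (x + y) ^ 2 := by
  wlog hxy : x ≤ y generalizing x y
  · rw [mul_comm x, add_comm x]
    exact this y x (le_of_not_ge hxy)
  obtain ⟨z, rfl⟩ := exists_add_of_le hxy
  calc 4 * (x * (x + z)) ≤ 4 * (x * (x + z)) + z ^ 2 := le_self_add
    _ = _ := by ring

/-- The one-dimensional Prékopa-Leindler inequality for functions with supremum one, in its
additive form. -/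
theorem lintegral_add_lintegral_le_two_mul {f g h : ℝ → ℝ≥0∞} (hf : Measurable f)
    (hg : Measurable g) (hh : Measurable h) (hf1 : ⨆ x, f x = 1) (hg1 : ⨆ x, g x = 1)
    (hfg : ∀ x y, f x * g y ≤ h ((1 / 2 : ℝ) * (x + y)) ^ 2) :
    (∫⁻ x, f x) + ∫⁻ x, g x ≤ 2 * ∫⁻ x, h x := by
  have hfle : ∀ x, f x ≤ 1 := fun x => hf1 ▸ le_iSup f x
  have hgle : ∀ x, g x ≤ 1 := fun x => hg1 ▸ le_iSup g x
  -- Truncating makes `h` finite for the layer-cake formula. Nothing is lost, since only levels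
  -- below `1` matter; there the superlevel sets of `f` and `g` are nonempty because both suprema
  -- are `1`.
  have hh1 : ∫⁻ x, min (h x) 1 ≤ ∫⁻ x, h x := lintegral_mono fun x => min_le_left _ _
  refine le_trans ?_ (mul_le_mul_right hh1 2)
  rw [lintegral_eq_lintegral_measure_ofReal_lt _ hf fun x => ((hfle x).trans_lt (by simp)).ne,
    lintegral_eq_lintegral_measure_ofReal_lt _ hg fun x => ((hgle x).trans_lt (by simp)).ne,
    lintegral_eq_lintegral_measure_ofReal_lt _ (hh.min measurable_const)
      fun x => ((min_le_right _ _).trans_lt (by simp)).ne,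
    ← lintegral_const_mul' _ _ (by simp)]
  refine (le_lintegral_add _ _).trans (lintegral_mono fun t => ?_)
  rcases lt_or_ge (ENNReal.ofReal t) 1 with ht | ht
  · refine MeasurableSet.volume_add_volume_le_two_mul (measurableSet_lt measurable_const hf)
      (measurableSet_lt measurable_const hg) ?_ ?_ ?_
    · exact lt_iSup_iff.1 (hf1.symm ▸ ht)
    · exact lt_iSup_iff.1 (hg1.symm ▸ ht)
    · intro x hx y hy
      refine lt_min ?_ ht
      have h1 : ENNReal.ofReal t ^ 2 < f x * g y := by
        rw [sq]
        exact ENNReal.mul_lt_mul hx hy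
      exact not_le.1 fun hle => (h1.trans_le (hfg x y)).not_ge (pow_le_pow_left' hle 2)
  · have e1 : {x | ENNReal.ofReal t < f x} = ∅ := by
      ext x; simpa using (hfle x).trans ht
    have e2 : {x | ENNReal.ofReal t < g x} = ∅ := by
      ext x; simpa using (hgle x).trans ht
    simp [e1, e2]

/-- Scaling `f` and `g` to supremum one, and `h` by the geometric mean of the two factors, gives the
additive form; `4xy ≤ (x + y)²` turns it multiplicative, and the scalings cancel. Boundedness keeps
the suprema finite. -/
theorem lintegral_mul_lintegral_le_sq_of_bounded {f g h : ℝ → ℝ≥0∞} (hf : Measurable f)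
    (hg : Measurable g) (hh : Measurable h) {k : ℝ≥0∞} (hk : k ≠ ∞) (hfk : ∀ x, f x ≤ k)
    (hgk : ∀ x, g x ≤ k) (hfg : ∀ x y, f x * g y ≤ h ((1 / 2 : ℝ) * (x + y)) ^ 2) :
    (∫⁻ x, f x) * ∫⁻ x, g x ≤ (∫⁻ x, h x) ^ 2 := by
  set M := ⨆ x, f x with hM
  set N := ⨆ x, g x with hN
  rcases eq_or_ne M 0 with hM0 | hM0
  · have : f = 0 := by
      ext x; exact le_zero_iff.1 (hM0 ▸ le_iSup f x)
    simp [this]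
  rcases eq_or_ne N 0 with hN0 | hN0
  · have : g = 0 := by
      ext x; exact le_zero_iff.1 (hN0 ▸ le_iSup g x)
    simp [this]
  have hMt : M ≠ ∞ := ((iSup_le hfk).trans_lt hk.lt_top).ne
  have hNt : N ≠ ∞ := ((iSup_le hgk).trans_lt hk.lt_top).ne
  set S : ℝ≥0∞ := (M⁻¹ * N⁻¹) ^ (1 / 2 : ℝ) with hS
  have hS2 : S ^ 2 = M⁻¹ * N⁻¹ := by
    rw [hS, ← ENNReal.rpow_natCast, ← ENNReal.rpow_mul]
    norm_num
  have key := lintegral_add_lintegral_le_two_mul (f := fun x => M⁻¹ * f x)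
    (g := fun x => N⁻¹ * g x) (h := fun x => S * h x) (hf.const_mul _) (hg.const_mul _)
    (hh.const_mul _) (by rw [← ENNReal.mul_iSup, ENNReal.inv_mul_cancel hM0 hMt])
    (by rw [← ENNReal.mul_iSup, ENNReal.inv_mul_cancel hN0 hNt]) (by
      intro x y
      rw [mul_pow, hS2, mul_mul_mul_comm]
      exact mul_le_mul_right (hfg x y) _)
  rw [lintegral_const_mul _ hf, lintegral_const_mul _ hg, lintegral_const_mul _ hh] at key
  have k2 := (ENNReal.four_mul_mul_le_add_sq _ _).trans (pow_le_pow_left₀ zero_le key 2)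
  have e1 : ∀ F G : ℝ≥0∞, 4 * (M⁻¹ * F * (N⁻¹ * G)) = (4 * (M⁻¹ * N⁻¹)) * (F * G) :=
    fun F G => by ring
  have e2 : ∀ H : ℝ≥0∞, (2 * (S * H)) ^ 2 = (4 * (M⁻¹ * N⁻¹)) * H ^ 2 := fun H => by
    rw [← hS2]; ring
  rw [e1, e2] at k2
  refine (ENNReal.mul_le_mul_iff_right ?_ ?_).1 k2
  · simp [hMt, hNt]
  · finiteness

/-- The one-dimensional Prékopa-Leindler inequality for midpoints. -/
theorem Real.lintegral_mul_lintegral_le_sq {f g h : ℝ → ℝ≥0∞} (hf : Measurable f)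
    (hg : Measurable g) (hh : Measurable h)
    (hfg : ∀ x y, f x * g y ≤ h ((1 / 2 : ℝ) * (x + y)) ^ 2) :
    (∫⁻ x, f x) * ∫⁻ x, g x ≤ (∫⁻ x, h x) ^ 2 := by
  have happ : ∀ φ : ℝ → ℝ≥0∞, Measurable φ →
      Tendsto (fun k : ℕ => ∫⁻ x, min (φ x) k) atTop (𝓝 (∫⁻ x, φ x)) := by
    intro φ hφ
    refine lintegral_tendsto_of_tendsto_of_monotone
      (fun k => (hφ.min measurable_const).aemeasurable) ?_ ?_
    · exact ae_of_all _ fun x i j hij => min_le_min_left _ (by exact_mod_cast hij)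
    · refine ae_of_all _ fun x => ?_
      have : Tendsto (fun k : ℕ => min (φ x) (k : ℝ≥0∞)) atTop (𝓝 (min (φ x) ∞)) :=
        tendsto_const_nhds.min ENNReal.tendsto_nat_nhds_top
      simpa using this
  -- Vanishing integrals are split off because multiplication on `ℝ≥0∞` is discontinuous at `0 · ∞`.
  rcases eq_or_ne (∫⁻ x, f x) 0 with h0 | hf0
  · simp [h0]
  rcases eq_or_ne (∫⁻ x, g x) 0 with h0 | hg0
  · simp [h0]
  refine le_of_tendsto (ENNReal.Tendsto.mul (happ f hf) (Or.inl hf0) (happ g hg) (Or.inl hg0))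
    (Eventually.of_forall fun k => ?_)
  exact lintegral_mul_lintegral_le_sq_of_bounded (hf.min measurable_const)
    (hg.min measurable_const) hh (ENNReal.natCast_ne_top k) (fun x => min_le_right _ _)
    (fun x => min_le_right _ _)
    fun x y => (mul_le_mul' (min_le_left _ _) (min_le_left _ _)).trans (hfg x y)

/-- The Prékopa-Leindler inequality for midpoints. -/
theorem prekopa_leindler_midpoint (n : ℕ) {f g h : (Fin n → ℝ) → ℝ≥0∞} (hf : Measurable f)
    (hg : Measurable g) (hh : Measurable h)
    (hfg : ∀ x y, f x * g y ≤ h ((1 / 2 : ℝ) • (x + y)) ^ 2) :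
    (∫⁻ x, f x) * ∫⁻ x, g x ≤ (∫⁻ x, h x) ^ 2 := by
  induction n with
  | zero =>
    rw [volume_pi, Measure.pi_of_empty _ 0, lintegral_dirac, lintegral_dirac, lintegral_dirac]
    simpa using hfg 0 0
  | succ n ih =>
    let e := MeasurableEquiv.piFinSuccAbove (fun _ : Fin (n + 1) => ℝ) 0
    have he : MeasurePreserving e.symm :=
      (volume_preserving_piFinSuccAbove (fun _ : Fin (n + 1) => ℝ) 0).symm e
    have hint : ∀ φ : (Fin (n + 1) → ℝ) → ℝ≥0∞, Measurable φ →
        ∫⁻ x, φ x = ∫⁻ s : ℝ, ∫⁻ v : Fin n → ℝ, φ (e.symm (s, v)) := by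
      intro φ hφ
      rw [← he.lintegral_comp hφ, Measure.volume_eq_prod,
        lintegral_prod (fun p => φ (e.symm p)) (hφ.comp e.symm.measurable).aemeasurable]
    have hmeas : ∀ φ : (Fin (n + 1) → ℝ) → ℝ≥0∞, Measurable φ →
        Measurable fun p : ℝ × (Fin n → ℝ) => φ (e.symm p) :=
      fun φ hφ => hφ.comp e.symm.measurable
    have hmid : ∀ (s t : ℝ) (v w : Fin n → ℝ), (1 / 2 : ℝ) • (e.symm (s, v) + e.symm (t, w)) =
        e.symm ((1 / 2 : ℝ) * (s + t), (1 / 2 : ℝ) • (v + w)) := by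
      intro s t v w
      ext i
      refine Fin.cases ?_ (fun j => ?_) i <;> simp [e, mul_add]
    rw [hint f hf, hint g hg, hint h hh]
    refine Real.lintegral_mul_lintegral_le_sq (hmeas f hf).lintegral_prod_right'
      (hmeas g hg).lintegral_prod_right' (hmeas h hh).lintegral_prod_right' fun s t => ?_
    -- For fixed `s`, `t` the slices satisfy the hypothesis in dimension `n`; its conclusion is the
    -- midpoint condition on the partial integrals required by the one-dimensional case.
    refine ih ((hmeas f hf).comp measurable_prodMk_left)
      ((hmeas g hg).comp measurable_prodMk_left) ((hmeas h hh).comp measurable_prodMk_left)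
      fun v w => ?_
    have := hfg (e.symm (s, v)) (e.symm (t, w))
    rwa [hmid] at this

theorem EuclideanSpace.prekopa_leindler_midpoint {d : ℕ}
    {f g h : EuclideanSpace ℝ (Fin d) → ℝ≥0∞} (hf : Measurable f) (hg : Measurable g)
    (hh : Measurable h) (hfg : ∀ x y, f x * g y ≤ h ((1 / 2 : ℝ) • (x + y)) ^ 2) :
    (∫⁻ x, f x) * ∫⁻ x, g x ≤ (∫⁻ x, h x) ^ 2 := by
  have he := PiLp.volume_preserving_toLp (Fin d)
  rw [← he.lintegral_comp hf, ← he.lintegral_comp hg, ← he.lintegral_comp hh]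
  refine _root_.prekopa_leindler_midpoint d (hf.comp he.measurable) (hg.comp he.measurable)
    (hh.comp he.measurable) fun x y => ?_
  exact hfg _ _

/-! ### Midpoint log-concave measures -/

/-- A measure is midpoint log-concave if `μ(A) μ(B) ≤ μ(C)²` whenever `C` contains all midpoints
between points of `A` and of `B`. -/
def IsMidpointLogConcave {E : Type*} [AddCommGroup E] [Module ℝ E] [MeasurableSpace E]
    (μ : Measure E) : Prop :=
  ∀ A B C : Set E, MeasurableSet A → MeasurableSet B → MeasurableSet C →
    (∀ x ∈ A, ∀ y ∈ B, (1 / 2 : ℝ) • (x + y) ∈ C) → μ A * μ B ≤ μ C ^ 2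

/-- Prékopa-Leindler applied to `w` restricted to `A`, `B` and `C`. -/
theorem isMidpointLogConcave_withDensity {d : ℕ} {w : EuclideanSpace ℝ (Fin d) → ℝ≥0∞}
    (hw : Measurable w) (hmid : ∀ x y, w x * w y ≤ w ((1 / 2 : ℝ) • (x + y)) ^ 2) :
    IsMidpointLogConcave (volume.withDensity w) := by
  intro A B C hA hB hC h
  rw [withDensity_apply _ hA, withDensity_apply _ hB, withDensity_apply _ hC,
    ← lintegral_indicator hA, ← lintegral_indicator hB, ← lintegral_indicator hC]
  refine EuclideanSpace.prekopa_leindler_midpoint (hw.indicator hA) (hw.indicator hB)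
    (hw.indicator hC) fun x y => ?_
  by_cases hx : x ∈ A
  · by_cases hy : y ∈ B
    · simpa only [Set.indicator_of_mem hx, Set.indicator_of_mem hy,
        Set.indicator_of_mem (h x hx y hy)] using hmid x y
    · simp [hy]
  · simp [hx]

/-! ### Tail estimates from dyadic shells -/

section Tail

variable {E : Type*} [NormedAddCommGroup E]

/-- The shells `2ᵏ a - r ≤ ‖x‖ ≤ 2ᵏ⁺¹ a + r`. -/
def dyadicShell (E : Type*) [NormedAddCommGroup E] (a r : ℝ) (k : ℕ) : Set E :=
  {x | 2 ^ k * a - r ≤ ‖x‖ ∧ ‖x‖ ≤ 2 ^ k * (2 * a) + r}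

theorem isClosed_dyadicShell (a r : ℝ) (k : ℕ) : IsClosed (dyadicShell E a r k) :=
  (isClosed_le continuous_const continuous_norm).inter
    (isClosed_le continuous_norm continuous_const)

/-- The margin `r` in the shells is chosen to be reproduced: averaging a margin `r` with a ball
radius `r` gives `r` again. -/
theorem half_smul_add_mem_dyadicShell [NormedSpace ℝ E] {a r : ℝ} {k : ℕ} {x y : E}
    (hx : x ∈ Metric.closedBall (0 : E) r) (hy : y ∈ dyadicShell E a r (k + 1)) :
    (1 / 2 : ℝ) • (x + y) ∈ dyadicShell E a r k := by
  rw [mem_closedBall_zero_iff] at hx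
  obtain ⟨h1, h2⟩ := hy
  have h3 : ‖(1 / 2 : ℝ) • (x + y)‖ = 1 / 2 * ‖x + y‖ := by
    rw [norm_smul]; norm_num
  have h4 := norm_add_le x y
  have h5 : ‖y‖ ≤ ‖x + y‖ + ‖x‖ := by
    simpa using norm_sub_le (x + y) x
  rw [pow_succ] at h1 h2
  constructor <;> rw [h3] <;> linarith

theorem exists_mem_dyadicShell {a r : ℝ} (ha : 0 < a) (hr : 0 ≤ r) {x : E} (hx : a - r ≤ ‖x‖) :
    ∃ k, x ∈ dyadicShell E a r k := by
  obtain ⟨k, hk1, hk2⟩ := exists_nat_pow_near (x := (‖x‖ + r) / a) (y := 2)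
    (by rw [le_div_iff₀ ha]; linarith) (by norm_num)
  rw [le_div_iff₀ ha] at hk1
  rw [div_lt_iff₀ ha, pow_succ] at hk2
  exact ⟨k, by linarith, by linarith⟩

variable [NormedSpace ℝ E] [MeasurableSpace E] [BorelSpace E]

/-- Averaging with the ball gives `c μ(S_{k+1}) ≤ μ(S_k)²`, so the bound on `μ(S_k) / c` squares at
each step. -/
theorem IsMidpointLogConcave.measure_dyadicShell_le {μ : Measure E} (hμ : IsMidpointLogConcave μ)
    {a r : ℝ} {c δ : ℝ≥0∞} (hc0 : c ≠ 0) (hct : c ≠ ∞) (hc : c ≤ μ (Metric.closedBall 0 r))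
    (hδ : μ (dyadicShell E a r 0) ≤ c * δ) (k : ℕ) :
    μ (dyadicShell E a r k) ≤ c * δ ^ 2 ^ k := by
  induction k with
  | zero => simpa using hδ
  | succ k ih =>
    have h1 := hμ _ _ _ Metric.isClosed_closedBall.measurableSet
      (isClosed_dyadicShell a r (k + 1)).measurableSet (isClosed_dyadicShell a r k).measurableSet
      fun x hx y hy => half_smul_add_mem_dyadicShell hx hy
    refine (ENNReal.mul_le_mul_iff_right hc0 hct).1 ?_
    calc c * μ (dyadicShell E a r (k + 1)) ≤ μ (Metric.closedBall 0 r) * _ :=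
          mul_le_mul_left hc _
      _ ≤ _ := h1
      _ ≤ (c * δ ^ 2 ^ k) ^ 2 := pow_le_pow_left' ih 2
      _ = _ := by rw [pow_succ 2 k, pow_mul]; ring

/-- Borell-type tail estimate for midpoint log-concave measures. -/
theorem IsMidpointLogConcave.setLIntegral_exp_norm_le {μ : Measure E}
    (hμ : IsMidpointLogConcave μ) {a r ε : ℝ} {c δ : ℝ≥0∞} (ha : 0 < a) (hr : 0 ≤ r)
    (hε : 0 ≤ ε) (hc0 : c ≠ 0) (hct : c ≠ ∞) (hc : c ≤ μ (Metric.closedBall 0 r))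
    (hδ : μ (dyadicShell E a r 0) ≤ c * δ)
    (hδε : ENNReal.ofReal (Real.exp (ε * (2 * a))) * δ ≤ 2⁻¹) :
    ∫⁻ x in {x | a - r ≤ ‖x‖}, ENNReal.ofReal (Real.exp (ε * ‖x‖)) ∂μ ≤
      2 * c * ENNReal.ofReal (Real.exp (ε * (2 * a + r))) * δ := by
  have hsub : {x : E | a - r ≤ ‖x‖} ⊆ ⋃ k, dyadicShell E a r k := fun x hx =>
    Set.mem_iUnion.2 (exists_mem_dyadicShell ha hr hx)
  set κ := ENNReal.ofReal (Real.exp (ε * (2 * a))) * δ with hκ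
  set C := ENNReal.ofReal (Real.exp (ε * r)) with hC
  have hterm : ∀ k, ∫⁻ x in dyadicShell E a r k, ENNReal.ofReal (Real.exp (ε * ‖x‖)) ∂μ ≤
      C * c * κ * 2⁻¹ ^ k := by
    intro k
    calc _ ≤ ∫⁻ x in dyadicShell E a r k,
            C * ENNReal.ofReal (Real.exp (ε * (2 * a))) ^ 2 ^ k ∂μ := by
          refine setLIntegral_mono measurable_const fun x hx => ?_
          rw [hC, ← ENNReal.ofReal_pow (Real.exp_nonneg _),
            ← ENNReal.ofReal_mul (Real.exp_nonneg _), ← Real.exp_nat_mul, ← Real.exp_add]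
          refine ENNReal.ofReal_le_ofReal (Real.exp_le_exp.2 ?_)
          calc ε * ‖x‖ ≤ ε * (2 ^ k * (2 * a) + r) := mul_le_mul_of_nonneg_left hx.2 hε
            _ = _ := by push_cast; ring
      _ = C * ENNReal.ofReal (Real.exp (ε * (2 * a))) ^ 2 ^ k * μ (dyadicShell E a r k) :=
          setLIntegral_const _ _
      _ ≤ C * ENNReal.ofReal (Real.exp (ε * (2 * a))) ^ 2 ^ k * (c * δ ^ 2 ^ k) :=
          mul_le_mul_right (hμ.measure_dyadicShell_le hc0 hct hc hδ k) _
      _ = C * c * κ ^ 2 ^ k := by rw [hκ, mul_pow]; ring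
      -- Since `κ ≤ 1` and `k + 1 ≤ 2 ^ k`, a geometric series suffices; one factor `κ` is kept so
      -- that the final bound is proportional to `δ`.
      _ ≤ C * c * κ ^ (k + 1) := by
          refine mul_le_mul_right (pow_le_pow_right_of_le_one' ?_ Nat.lt_two_pow_self) _
          exact hδε.trans (by simp)
      _ = C * c * κ * κ ^ k := by ring
      _ ≤ _ := mul_le_mul_right (pow_le_pow_left' hδε k) _
  calc _ ≤ ∫⁻ x in ⋃ k, dyadicShell E a r k, ENNReal.ofReal (Real.exp (ε * ‖x‖)) ∂μ :=
        lintegral_mono_set hsub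
    _ ≤ ∑' k, ∫⁻ x in dyadicShell E a r k, ENNReal.ofReal (Real.exp (ε * ‖x‖)) ∂μ :=
        lintegral_iUnion_le _ _
    _ ≤ ∑' k, C * c * κ * 2⁻¹ ^ k := ENNReal.tsum_le_tsum hterm
    _ = C * c * κ * 2 := by
        rw [ENNReal.tsum_mul_left, ENNReal.tsum_geometric, ENNReal.one_sub_inv_two, inv_inv]
    _ = _ := by
        rw [hκ, hC, mul_add, Real.exp_add, ENNReal.ofReal_mul (Real.exp_nonneg _)]
        ring

end Tail

/-! ### Exponential moments under weak convergence -/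

section WeakLimit

variable {d : ℕ}

theorem measurable_ofReal_exp_inner (θ : EuclideanSpace ℝ (Fin d)) :
    Measurable fun x : EuclideanSpace ℝ (Fin d) => ENNReal.ofReal (Real.exp (inner ℝ θ x)) := by
  fun_prop

/-- The exponential tilt `exp(θᵀ x) dν(x)`. -/
noncomputable def expTilt (ν : Measure (EuclideanSpace ℝ (Fin d)))
    (θ : EuclideanSpace ℝ (Fin d)) : Measure (EuclideanSpace ℝ (Fin d)) :=
  ν.withDensity fun x => ENNReal.ofReal (Real.exp (inner ℝ θ x))

theorem lintegral_expTilt (ν : Measure (EuclideanSpace ℝ (Fin d)))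
    (θ : EuclideanSpace ℝ (Fin d)) {g : EuclideanSpace ℝ (Fin d) → ℝ≥0∞} (hg : Measurable g) :
    ∫⁻ x, g x ∂(expTilt ν θ) = ∫⁻ x, g x * ENNReal.ofReal (Real.exp (inner ℝ θ x)) ∂ν := by
  rw [expTilt, lintegral_withDensity_eq_lintegral_mul _ (measurable_ofReal_exp_inner θ) hg]
  simp only [Pi.mul_apply, mul_comm]

theorem expTilt_univ (ν : Measure (EuclideanSpace ℝ (Fin d))) (θ : EuclideanSpace ℝ (Fin d)) :
    expTilt ν θ Set.univ = expMoment ν θ := by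
  rw [expTilt, withDensity_apply _ MeasurableSet.univ, Measure.restrict_univ, expMoment]

/-- The factor `exp(θᵀx)` is log-affine, so it satisfies the midpoint condition with equality. -/
theorem IsLogConcaveDensity.isMidpointLogConcave_expTilt {f : EuclideanSpace ℝ (Fin d) → ℝ}
    (hf : IsLogConcaveDensity f) (θ : EuclideanSpace ℝ (Fin d)) :
    IsMidpointLogConcave (expTilt (volume.withDensity fun x => ENNReal.ofReal (f x)) θ) := by
  have hfm : Measurable fun x => ENNReal.ofReal (f x) :=
    hf.upperSemicontinuous.measurable.ennreal_ofReal
  rw [expTilt, ← withDensity_mul _ hfm (measurable_ofReal_exp_inner θ)]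
  refine isMidpointLogConcave_withDensity (hfm.mul (measurable_ofReal_exp_inner θ)) fun x y => ?_
  simp only [Pi.mul_apply]
  rw [← ENNReal.ofReal_mul (hf.nonneg _), ← ENNReal.ofReal_mul (hf.nonneg _),
    ← ENNReal.ofReal_mul (hf.nonneg _),
    ← ENNReal.ofReal_mul (mul_nonneg (hf.nonneg _) (Real.exp_nonneg _)),
    ← ENNReal.ofReal_pow (mul_nonneg (hf.nonneg _) (Real.exp_nonneg _))]
  refine ENNReal.ofReal_le_ofReal ?_
  have h1 := hf.logConcave x y (1 / 2) (1 / 2) (by norm_num) (by norm_num) (by norm_num)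
  rw [← Real.sqrt_eq_rpow, ← Real.sqrt_eq_rpow, ← smul_add] at h1
  have h2 : f x * f y ≤ f ((1 / 2 : ℝ) • (x + y)) ^ 2 := by
    have := pow_le_pow_left₀ (by positivity) h1 2
    rwa [mul_pow, Real.sq_sqrt (hf.nonneg _), Real.sq_sqrt (hf.nonneg _)] at this
  have h3 : Real.exp (inner ℝ θ x) * Real.exp (inner ℝ θ y) =
      Real.exp (inner ℝ θ ((1 / 2 : ℝ) • (x + y))) ^ 2 := by
    rw [← Real.exp_add, ← Real.exp_nat_mul, inner_smul_right, inner_add_right]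
    congr 1
    push_cast
    ring
  rw [mul_pow, ← h3, mul_mul_mul_comm]
  exact mul_le_mul_of_nonneg_right h2 (by positivity)

/-- A continuous cutoff function, `1` on the ball of radius `R` and `0` outside the ball of
radius `R + 1`. -/
def radialCutoff {E : Type*} [NormedAddCommGroup E] (R : ℝ) (x : E) : ℝ :=
  max 0 (min 1 (R + 1 - ‖x‖))

section Cutoff

variable {E : Type*} [NormedAddCommGroup E]

theorem continuous_radialCutoff (R : ℝ) : Continuous (radialCutoff (E := E) R) := by
  unfold radialCutoff; fun_prop

theorem radialCutoff_nonneg (R : ℝ) (x : E) : 0 ≤ radialCutoff R x := le_max_left _ _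

theorem radialCutoff_le_one (R : ℝ) (x : E) : radialCutoff R x ≤ 1 :=
  max_le zero_le_one (min_le_left _ _)

theorem radialCutoff_of_le {R : ℝ} {x : E} (h : ‖x‖ ≤ R) : radialCutoff R x = 1 := by
  rw [radialCutoff, min_eq_left (by linarith), max_eq_right zero_le_one]

theorem radialCutoff_of_ge {R : ℝ} {x : E} (h : R + 1 ≤ ‖x‖) : radialCutoff R x = 0 := by
  rw [radialCutoff, max_eq_left (min_le_of_right_le (by linarith))]

end Cutoff

theorem tendsto_lintegral_of_eq_zero_off_ball
    {νs : ℕ → ProbabilityMeasure (EuclideanSpace ℝ (Fin d))}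
    {ν : ProbabilityMeasure (EuclideanSpace ℝ (Fin d))} (hlim : Tendsto νs atTop (𝓝 ν))
    {g : EuclideanSpace ℝ (Fin d) → ℝ} (hg : Continuous g) (R : ℝ)
    (hR : ∀ x, R < ‖x‖ → g x = 0) :
    Tendsto (fun n => ∫⁻ x, ENNReal.ofReal (g x) ∂(νs n : Measure (EuclideanSpace ℝ (Fin d))))
      atTop (𝓝 (∫⁻ x, ENNReal.ofReal (g x) ∂(ν : Measure (EuclideanSpace ℝ (Fin d))))) := by
  have hcs : HasCompactSupport g := HasCompactSupport.intro (isCompact_closedBall 0 R) fun x hx =>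
    hR x (by simpa using hx)
  obtain ⟨C, hC⟩ := hcs.exists_bound_of_continuous hg
  exact ProbabilityMeasure.tendsto_iff_forall_lintegral_tendsto.1 hlim
    (BoundedContinuousFunction.ofNormedAddCommGroup g hg C hC).nnrealPart

/-- A Fatou lemma for weak convergence: the portmanteau inequality on open superlevel sets, so `g`
may be unbounded. -/
theorem lintegral_le_liminf_lintegral {νs : ℕ → ProbabilityMeasure (EuclideanSpace ℝ (Fin d))}
    {ν : ProbabilityMeasure (EuclideanSpace ℝ (Fin d))} (hlim : Tendsto νs atTop (𝓝 ν))
    {g : EuclideanSpace ℝ (Fin d) → ℝ} (hg : Continuous g) (hg0 : 0 ≤ g) :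
    ∫⁻ x, ENNReal.ofReal (g x) ∂(ν : Measure (EuclideanSpace ℝ (Fin d))) ≤
      liminf (fun n => ∫⁻ x, ENNReal.ofReal (g x)
        ∂(νs n : Measure (EuclideanSpace ℝ (Fin d)))) atTop :=
  lintegral_le_liminf_lintegral_of_forall_isOpen_measure_le_liminf_measure hg hg0 fun _ hG =>
    ProbabilityMeasure.le_liminf_measure_open_of_tendsto hlim hG

theorem expMoment_le_liminf {νs : ℕ → ProbabilityMeasure (EuclideanSpace ℝ (Fin d))}
    {ν : ProbabilityMeasure (EuclideanSpace ℝ (Fin d))} (hlim : Tendsto νs atTop (𝓝 ν))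
    (θ : EuclideanSpace ℝ (Fin d)) :
    expMoment (ν : Measure (EuclideanSpace ℝ (Fin d))) θ ≤
      liminf (fun n => expMoment (νs n : Measure (EuclideanSpace ℝ (Fin d))) θ) atTop :=
  lintegral_le_liminf_lintegral hlim (by fun_prop) fun x => (Real.exp_pos _).le

theorem exists_lintegral_radialCutoff_ne_zero (ν : ProbabilityMeasure (EuclideanSpace ℝ (Fin d)))
    (θ : EuclideanSpace ℝ (Fin d)) :
    ∃ R : ℕ, ∫⁻ x, ENNReal.ofReal (radialCutoff R x * Real.exp (inner ℝ θ x))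
      ∂(ν : Measure (EuclideanSpace ℝ (Fin d))) ≠ 0 := by
  by_contra! h
  have h' : ∀ᵐ x ∂(ν : Measure (EuclideanSpace ℝ (Fin d))), ∀ R : ℕ,
      ENNReal.ofReal (radialCutoff R x * Real.exp (inner ℝ θ x)) = 0 := by
    rw [ae_all_iff]
    intro R
    have hc := continuous_radialCutoff (E := EuclideanSpace ℝ (Fin d)) R
    exact (lintegral_eq_zero_iff (by fun_prop)).1 (h R)
  obtain ⟨x, hx⟩ := h'.exists
  obtain ⟨R, hR⟩ := exists_nat_ge ‖x‖
  have := hx R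
  rw [radialCutoff_of_le hR, one_mul, ENNReal.ofReal_eq_zero] at this
  exact this.not_gt (Real.exp_pos _)

theorem exists_lintegral_one_sub_radialCutoff_lt
    {ν : ProbabilityMeasure (EuclideanSpace ℝ (Fin d))} {θ : EuclideanSpace ℝ (Fin d)}
    (hθ : θ ∈ expMomentDomain (ν : Measure (EuclideanSpace ℝ (Fin d)))) {η : ℝ≥0∞}
    (hη : η ≠ 0) :
    ∃ R : ℕ, ∫⁻ x, ENNReal.ofReal ((1 - radialCutoff R x) * Real.exp (inner ℝ θ x))
      ∂(ν : Measure (EuclideanSpace ℝ (Fin d))) < η := by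
  have hT : Tendsto (fun R : ℕ =>
      ∫⁻ x, ENNReal.ofReal ((1 - radialCutoff R x) * Real.exp (inner ℝ θ x))
        ∂(ν : Measure (EuclideanSpace ℝ (Fin d)))) atTop
      (𝓝 (∫⁻ _, 0 ∂(ν : Measure (EuclideanSpace ℝ (Fin d))))) := by
    refine tendsto_lintegral_of_dominated_convergence
      (fun x => ENNReal.ofReal (Real.exp (inner ℝ θ x))) (fun R => ?_) (fun R => ?_)
      (ne_of_lt hθ) ?_
    · have hc := continuous_radialCutoff (E := EuclideanSpace ℝ (Fin d)) R
      fun_prop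
    · refine ae_of_all _ fun x => ENNReal.ofReal_le_ofReal ?_
      have := radialCutoff_nonneg R x
      exact mul_le_of_le_one_left (Real.exp_nonneg _) (by linarith)
    · refine ae_of_all _ fun x => tendsto_const_nhds.congr' ?_
      obtain ⟨N, hN⟩ := exists_nat_ge ‖x‖
      filter_upwards [eventually_ge_atTop N] with R hR
      rw [radialCutoff_of_le (hN.trans (by exact_mod_cast hR))]
      simp
  rw [lintegral_zero] at hT
  exact (hT.eventually_lt_const (pos_iff_ne_zero.2 hη)).exists

theorem lintegral_mul_exp_le_expTilt (ν : Measure (EuclideanSpace ℝ (Fin d)))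
    (θ : EuclideanSpace ℝ (Fin d)) {g : EuclideanSpace ℝ (Fin d) → ℝ}
    {S : Set (EuclideanSpace ℝ (Fin d))} (hS : MeasurableSet S)
    (hg : ∀ x, x ∉ S → g x = 0) (hg1 : ∀ x, g x ≤ 1) :
    ∫⁻ x, ENNReal.ofReal (g x * Real.exp (inner ℝ θ x)) ∂ν ≤ expTilt ν θ S := by
  rw [expTilt, withDensity_apply _ hS, ← lintegral_indicator hS]
  refine lintegral_mono fun x => ?_
  by_cases hx : x ∈ S
  · rw [Set.indicator_of_mem hx]
    exact ENNReal.ofReal_le_ofReal (mul_le_of_le_one_left (Real.exp_nonneg _) (hg1 x))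
  · simp [hg x hx]

theorem expTilt_le_lintegral_mul_exp (ν : Measure (EuclideanSpace ℝ (Fin d)))
    (θ : EuclideanSpace ℝ (Fin d)) {g : EuclideanSpace ℝ (Fin d) → ℝ}
    {S : Set (EuclideanSpace ℝ (Fin d))} (hS : MeasurableSet S) (hg : ∀ x ∈ S, g x = 1) :
    expTilt ν θ S ≤ ∫⁻ x, ENNReal.ofReal (g x * Real.exp (inner ℝ θ x)) ∂ν := by
  rw [expTilt, withDensity_apply _ hS, ← lintegral_indicator hS]
  refine lintegral_mono fun x => ?_
  by_cases hx : x ∈ S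
  · simp [hx, hg x hx]
  · simp [hx]

/-- Along a weakly convergent sequence, the hypotheses of the tail estimate hold eventually. -/
theorem eventually_expTilt_dyadicShell_le
    {νs : ℕ → ProbabilityMeasure (EuclideanSpace ℝ (Fin d))}
    {ν : ProbabilityMeasure (EuclideanSpace ℝ (Fin d))} (hlim : Tendsto νs atTop (𝓝 ν))
    {θ : EuclideanSpace ℝ (Fin d)}
    (hθ : θ ∈ expMomentDomain (ν : Measure (EuclideanSpace ℝ (Fin d)))) {δ : ℝ≥0∞}
    (hδ : δ ≠ 0) :
    ∃ (a r : ℝ) (c : ℝ≥0∞), 0 < a ∧ 0 ≤ r ∧ c ≠ 0 ∧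
      c ≤ expMoment (ν : Measure (EuclideanSpace ℝ (Fin d))) θ ∧
      ∀ᶠ n in atTop, c ≤ expTilt (νs n) θ (Metric.closedBall 0 r) ∧
        expTilt (νs n) θ (dyadicShell _ a r 0) ≤ c * δ := by
  have hcut := fun R : ℝ => continuous_radialCutoff (E := EuclideanSpace ℝ (Fin d)) R
  obtain ⟨m, hm⟩ := exists_lintegral_radialCutoff_ne_zero ν θ
  set I := ∫⁻ x, ENNReal.ofReal (radialCutoff m x * Real.exp (inner ℝ θ x))
    ∂(ν : Measure (EuclideanSpace ℝ (Fin d))) with hI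
  have hIle : I ≤ expMoment (ν : Measure (EuclideanSpace ℝ (Fin d))) θ :=
    lintegral_mono fun x => ENNReal.ofReal_le_ofReal
      (mul_le_of_le_one_left (Real.exp_nonneg _) (radialCutoff_le_one _ _))
  have hIt : I ≠ ∞ := (hIle.trans_lt hθ).ne
  have hc0 : I / 2 ≠ 0 := (ENNReal.half_pos hm).ne'
  obtain ⟨R, hR⟩ := exists_lintegral_one_sub_radialCutoff_lt hθ (mul_ne_zero hc0 hδ)
  have hr : (0 : ℝ) ≤ m + 1 := by positivity
  -- With `r = m + 1` the ball contains the support of the cutoff defining `I`, and halving `I`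
  -- leaves room for the limit. The choice of `a` makes `a - r = R + 1`, so the first shell lies
  -- where `1 - radialCutoff R` equals `1`.
  refine ⟨R + 1 + (m + 1), m + 1, I / 2, by positivity, hr, hc0, ENNReal.half_le_self.trans hIle,
    ?_⟩
  have h1 := (tendsto_lintegral_of_eq_zero_off_ball hlim
    (g := fun x => radialCutoff m x * Real.exp (inner ℝ θ x))
    ((hcut m).mul (by fun_prop)) (m + 1) fun x hx => by
      rw [radialCutoff_of_ge hx.le, zero_mul]).eventually_const_lt
        (ENNReal.half_lt_self hm hIt)
  set L : ℝ := 2 * (R + 1 + (m + 1)) + (m + 1) with hL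
  have h2 := (tendsto_lintegral_of_eq_zero_off_ball hlim
    (g := fun x => (radialCutoff L x * (1 - radialCutoff R x)) * Real.exp (inner ℝ θ x))
    (((hcut L).mul (continuous_const.sub (hcut R))).mul (by fun_prop)) (L + 1) fun x hx => by
      rw [radialCutoff_of_ge hx.le, zero_mul, zero_mul]).eventually_lt_const
        (u := I / 2 * δ) (lt_of_le_of_lt (lintegral_mono fun x => ENNReal.ofReal_le_ofReal <|
          mul_le_mul_of_nonneg_right (mul_le_of_le_one_left
            (sub_nonneg.2 (radialCutoff_le_one _ _)) (radialCutoff_le_one _ _))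
              (Real.exp_nonneg _)) hR)
  filter_upwards [h1, h2] with n hn1 hn2
  constructor
  · refine hn1.le.trans (lintegral_mul_exp_le_expTilt _ θ
      Metric.isClosed_closedBall.measurableSet (fun x hx => ?_) (radialCutoff_le_one _))
    rw [mem_closedBall_zero_iff, not_le] at hx
    exact radialCutoff_of_ge hx.le
  · refine le_trans (expTilt_le_lintegral_mul_exp _ θ (isClosed_dyadicShell _ _ _).measurableSet
      fun x hx => ?_) hn2.le
    obtain ⟨hx1, hx2⟩ := hx
    rw [radialCutoff_of_le (by linarith), radialCutoff_of_ge (by linarith)]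
    norm_num

/-- The lower bound is Fatou. For the upper bound, mass inside a ball is controlled by a cutoff and
weak convergence, mass outside by the uniform tail estimate with exponent `0`. -/
theorem tendsto_expMoment {νs : ℕ → ProbabilityMeasure (EuclideanSpace ℝ (Fin d))}
    {ν : ProbabilityMeasure (EuclideanSpace ℝ (Fin d))} (hlim : Tendsto νs atTop (𝓝 ν))
    {θ : EuclideanSpace ℝ (Fin d)} (hmid : ∀ n, IsMidpointLogConcave (expTilt (νs n) θ))
    (hθ : θ ∈ expMomentDomain (ν : Measure (EuclideanSpace ℝ (Fin d)))) :
    Tendsto (fun n => expMoment (νs n : Measure (EuclideanSpace ℝ (Fin d))) θ) atTop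
      (𝓝 (expMoment (ν : Measure (EuclideanSpace ℝ (Fin d))) θ)) := by
  refine tendsto_of_le_liminf_of_limsup_le (expMoment_le_liminf hlim θ) ?_
  set M := expMoment (ν : Measure (EuclideanSpace ℝ (Fin d))) θ with hM
  have hMt : M ≠ ∞ := ne_of_lt hθ
  refine ENNReal.le_of_forall_pos_le_add fun ε hε _ => ?_
  have hε2 : (ε : ℝ≥0∞) / 2 ≠ 0 := (ENNReal.half_pos (by exact_mod_cast hε.ne')).ne'
  obtain ⟨a, r, c, ha, hr, hc0, hcM, hev⟩ := eventually_expTilt_dyadicShell_le hlim hθ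
    -- The first entry meets the smallness condition of the tail estimate; the second makes the tail
    -- `2cδ ≤ 2Mδ` at most `ε / 2`.
    (δ := min 2⁻¹ (ε / 2 / (2 * M))) (by
      rw [← pos_iff_ne_zero, lt_min_iff]
      refine ⟨by simp, ENNReal.div_pos hε2 (by finiteness)⟩)
  have h1 := (tendsto_lintegral_of_eq_zero_off_ball hlim
    (g := fun x => radialCutoff (a - r) x * Real.exp (inner ℝ θ x))
    ((continuous_radialCutoff _).mul (by fun_prop)) (a - r + 1) fun x hx => by
      rw [radialCutoff_of_ge hx.le, zero_mul]).eventually_lt_const (u := M + ε / 2)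
        (lt_of_le_of_lt (lintegral_mono fun x => ENNReal.ofReal_le_ofReal
          (mul_le_of_le_one_left (Real.exp_nonneg _) (radialCutoff_le_one _ _)))
            (ENNReal.lt_add_right hMt hε2))
  refine limsup_le_of_le (by isBoundedDefault) ?_
  filter_upwards [hev, h1] with n hn hn1
  have htail := (hmid n).setLIntegral_exp_norm_le ha hr (ε := 0) le_rfl hc0
    (hcM.trans_lt hθ).ne hn.1 hn.2 (by simp)
  simp only [zero_mul, Real.exp_zero, ENNReal.ofReal_one, lintegral_const, one_mul, mul_one,
    Measure.restrict_apply, MeasurableSet.univ, Set.univ_inter] at htail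
  have hball : expTilt (νs n) θ (Metric.closedBall 0 (a - r)) ≤ M + ε / 2 :=
    (expTilt_le_lintegral_mul_exp _ θ Metric.isClosed_closedBall.measurableSet fun x hx =>
      radialCutoff_of_le (mem_closedBall_zero_iff.1 hx)).trans hn1.le
  have hcover : (Set.univ : Set (EuclideanSpace ℝ (Fin d))) ⊆
      Metric.closedBall 0 (a - r) ∪ {x | a - r ≤ ‖x‖} := fun x _ => by
    rcases le_total ‖x‖ (a - r) with h | h
    · exact Or.inl (mem_closedBall_zero_iff.2 h)
    · exact Or.inr h
  calc expMoment (νs n : Measure (EuclideanSpace ℝ (Fin d))) θ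
      = expTilt (νs n) θ Set.univ := (expTilt_univ _ _).symm
    _ ≤ _ := (measure_mono hcover).trans (measure_union_le _ _)
    _ ≤ (M + ε / 2) + 2 * c * min 2⁻¹ (ε / 2 / (2 * M)) := add_le_add hball htail
    _ ≤ (M + ε / 2) + 2 * M * (ε / 2 / (2 * M)) := by
        gcongr
        exact min_le_right _ _
    _ ≤ (M + ε / 2) + ε / 2 := by
        gcongr
        exact ENNReal.mul_div_le
    _ = M + ε := by rw [add_assoc, ENNReal.add_halves]

/-- For `‖η - θ‖ < ε`, `exp(ηᵀx) ≤ exp(ε‖x‖) exp(θᵀx)`. The tail estimate bounds the integral of the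
right side uniformly for large `n`, and Fatou passes the bound to `ν`. -/
theorem isOpen_expMomentDomain {νs : ℕ → ProbabilityMeasure (EuclideanSpace ℝ (Fin d))}
    {ν : ProbabilityMeasure (EuclideanSpace ℝ (Fin d))} (hlim : Tendsto νs atTop (𝓝 ν))
    (hmid : ∀ n θ, IsMidpointLogConcave
      (expTilt (νs n : Measure (EuclideanSpace ℝ (Fin d))) θ)) :
    IsOpen (expMomentDomain (ν : Measure (EuclideanSpace ℝ (Fin d)))) := by
  rw [Metric.isOpen_iff]
  intro θ hθ
  set M := expMoment (ν : Measure (EuclideanSpace ℝ (Fin d))) θ with hM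
  have hMt : M ≠ ∞ := ne_of_lt hθ
  obtain ⟨a, r, c, ha, hr, hc0, hcM, hev⟩ := eventually_expTilt_dyadicShell_le hlim hθ
    (δ := 2⁻¹ * 2⁻¹) (by simp)
  -- Then `exp(2aε) = 2`, and `δ = 1/4` gives exactly the product `1/2` that the tail estimate
  -- allows.
  set ε := Real.log 2 / (2 * a) with hεdef
  have hε : 0 < ε := div_pos (Real.log_pos one_lt_two) (by positivity)
  have h1 := (tendsto_expMoment hlim (fun n => hmid n θ) hθ).eventually_lt_const
    (u := M + 1) (ENNReal.lt_add_right hMt one_ne_zero)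
  set T : ℝ≥0∞ := 2 * c * ENNReal.ofReal (Real.exp (ε * (2 * a + r))) * (2⁻¹ * 2⁻¹) with hT
  set B : ℝ≥0∞ := ENNReal.ofReal (Real.exp (ε * (a - r))) * (M + 1) with hB
  have hct : c ≠ ∞ := (hcM.trans_lt hθ).ne
  refine ⟨ε, hε, fun η hη => ?_⟩
  have hbound : ∀ᶠ n in atTop,
      expMoment (νs n : Measure (EuclideanSpace ℝ (Fin d))) η ≤ B + T := by
    filter_upwards [hev, h1] with n hn hn1
    have htail := (hmid n θ).setLIntegral_exp_norm_le ha hr hε.le hc0 hct hn.1 hn.2 (by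
      rw [hεdef, div_mul_cancel₀ _ (by positivity), Real.exp_log two_pos, ENNReal.ofReal_ofNat,
        ← mul_assoc, ENNReal.mul_inv_cancel (by simp) (by simp), one_mul])
    have hball : ∫⁻ x in Metric.closedBall 0 (a - r), ENNReal.ofReal (Real.exp (ε * ‖x‖))
        ∂(expTilt (νs n) θ) ≤ B := by
      calc _ ≤ ∫⁻ x in Metric.closedBall 0 (a - r), ENNReal.ofReal (Real.exp (ε * (a - r)))
            ∂(expTilt (νs n) θ) := by
            refine setLIntegral_mono measurable_const fun x hx => ENNReal.ofReal_le_ofReal ?_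
            rw [mem_closedBall_zero_iff] at hx
            exact Real.exp_le_exp.2 (mul_le_mul_of_nonneg_left hx hε.le)
        _ = ENNReal.ofReal (Real.exp (ε * (a - r))) *
            expTilt (νs n) θ (Metric.closedBall 0 (a - r)) := setLIntegral_const _ _
        _ ≤ _ := by
            refine mul_le_mul_right ((measure_mono (Set.subset_univ _)).trans ?_) _
            rw [expTilt_univ]
            exact hn1.le
    have hcover : (Set.univ : Set (EuclideanSpace ℝ (Fin d))) ⊆
        Metric.closedBall 0 (a - r) ∪ {x | a - r ≤ ‖x‖} := fun x _ => by
      rcases le_total ‖x‖ (a - r) with h | h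
      · exact Or.inl (mem_closedBall_zero_iff.2 h)
      · exact Or.inr h
    calc expMoment (νs n : Measure (EuclideanSpace ℝ (Fin d))) η
        ≤ ∫⁻ x, ENNReal.ofReal (Real.exp (ε * ‖x‖)) * ENNReal.ofReal (Real.exp (inner ℝ θ x))
            ∂(νs n : Measure (EuclideanSpace ℝ (Fin d))) := by
          refine lintegral_mono fun x => ?_
          rw [← ENNReal.ofReal_mul (Real.exp_nonneg _), ← Real.exp_add]
          refine ENNReal.ofReal_le_ofReal (Real.exp_le_exp.2 ?_)
          have h2 := real_inner_le_norm (η - θ) x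
          rw [inner_sub_left] at h2
          have h3 : ‖η - θ‖ * ‖x‖ ≤ ε * ‖x‖ :=
            mul_le_mul_of_nonneg_right (mem_ball_iff_norm.1 hη).le (norm_nonneg _)
          linarith
      _ = ∫⁻ x in Set.univ, ENNReal.ofReal (Real.exp (ε * ‖x‖)) ∂(expTilt (νs n) θ) := by
          rw [Measure.restrict_univ, lintegral_expTilt _ _ (by fun_prop)]
      _ ≤ _ := (lintegral_mono_set hcover).trans (lintegral_union_le _ _ _)
      _ ≤ B + T := add_le_add hball htail
  have hfin : B + T < ∞ := by
    rw [hB, hT]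
    finiteness
  refine lt_of_le_of_lt ((expMoment_le_liminf hlim η).trans ?_) hfin
  exact liminf_le_of_frequently_le' hbound.frequently

end WeakLimit

/-! ### The structure of the domain `Θ` -/

section Domain

variable {d : ℕ}

theorem convex_expMomentDomain (ν : Measure (EuclideanSpace ℝ (Fin d))) :
    Convex ℝ (expMomentDomain ν) := by
  intro θ hθ η hη a b ha hb hab
  have hm := measurable_ofReal_exp_inner (d := d)
  have hle : expMoment ν (a • θ + b • η) ≤
      ENNReal.ofReal a * expMoment ν θ + ENNReal.ofReal b * expMoment ν η := by
    rw [expMoment, expMoment, expMoment, ← lintegral_const_mul _ (hm θ),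
      ← lintegral_const_mul _ (hm η), ← lintegral_add_left ((hm θ).const_mul _)]
    refine lintegral_mono fun x => ?_
    rw [← ENNReal.ofReal_mul ha, ← ENNReal.ofReal_mul hb,
      ← ENNReal.ofReal_add (by positivity) (by positivity), inner_add_left, real_inner_smul_left,
      real_inner_smul_left]
    exact ENNReal.ofReal_le_ofReal
      (convexOn_exp.2 (Set.mem_univ _) (Set.mem_univ _) ha hb hab)
  exact hle.trans_lt (ENNReal.add_lt_top.2 ⟨ENNReal.mul_lt_top ENNReal.ofReal_lt_top hθ,
    ENNReal.mul_lt_top ENNReal.ofReal_lt_top hη⟩)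

theorem zero_mem_expMomentDomain (ν : Measure (EuclideanSpace ℝ (Fin d))) [IsFiniteMeasure ν] :
    (0 : EuclideanSpace ℝ (Fin d)) ∈ expMomentDomain ν := by
  simp [expMomentDomain, expMoment]

/-- For `a` in the convex support, `x - a ∈ U` almost everywhere, so `uᵀx = uᵀa` and the moment only
gains the factor `exp(uᵀa)`. -/
theorem add_mem_expMomentDomain (ν : Measure (EuclideanSpace ℝ (Fin d))) [IsProbabilityMeasure ν]
    {θ u : EuclideanSpace ℝ (Fin d)} (hθ : θ ∈ expMomentDomain ν)
    (hu : u ∈ (supportDirection ν)ᗮ) : θ + u ∈ expMomentDomain ν := by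
  obtain ⟨hcl, -, hone⟩ := (isLeast_convexSupport ν).1
  obtain ⟨a, ha⟩ : (convexSupport ν).Nonempty := by
    by_contra hne
    simp [Set.not_nonempty_iff_eq_empty.1 hne] at hone
  have hae : ∀ᵐ x ∂ν, x ∈ convexSupport ν := by
    rw [ae_iff]
    exact (prob_compl_eq_zero_iff hcl.measurableSet).2 hone
  have heq : expMoment ν (θ + u) = ENNReal.ofReal (Real.exp (inner ℝ u a)) * expMoment ν θ := by
    rw [expMoment, expMoment, ← lintegral_const_mul _ (measurable_ofReal_exp_inner θ)]
    refine lintegral_congr_ae ?_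
    filter_upwards [hae] with x hx
    have hxa : x - a ∈ supportDirection ν :=
      AffineSubspace.vsub_mem_direction (subset_affineSpan ℝ _ hx) (subset_affineSpan ℝ _ ha)
    have h0 : inner ℝ u (x - a) = 0 := Submodule.inner_left_of_mem_orthogonal hxa hu
    rw [inner_sub_right, sub_eq_zero] at h0
    rw [← ENNReal.ofReal_mul (Real.exp_nonneg _), ← Real.exp_add, inner_add_left, h0, add_comm]
  change expMoment ν (θ + u) < ∞
  rw [heq]
  exact ENNReal.mul_lt_top ENNReal.ofReal_lt_top hθ

/-- An open domain `Θ` is the direct sum of its trace on `U` and `U^⊥`. -/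
theorem exists_expMomentDomain_eq_add (ν : Measure (EuclideanSpace ℝ (Fin d)))
    [IsProbabilityMeasure ν] (hopen : IsOpen (expMomentDomain ν)) :
    ∃ Θ₀ : Set (supportDirection ν), IsOpen Θ₀ ∧ Convex ℝ Θ₀ ∧ 0 ∈ Θ₀ ∧
      expMomentDomain ν = ((↑) '' Θ₀ : Set (EuclideanSpace ℝ (Fin d))) +
        ((supportDirection ν)ᗮ : Set (EuclideanSpace ℝ (Fin d))) := by
  refine ⟨Subtype.val ⁻¹' expMomentDomain ν, hopen.preimage continuous_subtype_val,
    (convex_expMomentDomain ν).linear_preimage (supportDirection ν).subtype,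
    by simpa using zero_mem_expMomentDomain ν, ?_⟩
  ext θ
  rw [Set.mem_add]
  constructor
  · intro hθ
    have hq : θ - (supportDirection ν).starProjection θ ∈ (supportDirection ν)ᗮ :=
      Submodule.sub_starProjection_mem_orthogonal θ
    refine ⟨(supportDirection ν).starProjection θ,
      ⟨⟨_, Submodule.starProjection_apply_mem _ θ⟩, ?_, rfl⟩, _, hq, add_sub_cancel _ _⟩
    have := add_mem_expMomentDomain ν hθ (neg_mem hq)
    rw [neg_sub, add_sub_cancel] at this
    exact this
  · rintro ⟨_, ⟨η, hη, rfl⟩, u, hu, rfl⟩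
    exact add_mem_expMomentDomain ν hη hu

end Domain

/-! ### Second moments and covariances -/

section Moments

variable {d : ℕ} {νs : ℕ → ProbabilityMeasure (EuclideanSpace ℝ (Fin d))}
  {ν : ProbabilityMeasure (EuclideanSpace ℝ (Fin d))}

/-- Convergence of integrals of continuous functions under weak convergence, dominated by a
function whose integrals converge. -/
theorem tendsto_lintegral_of_le_of_tendsto (hlim : Tendsto νs atTop (𝓝 ν))
    {g G : EuclideanSpace ℝ (Fin d) → ℝ} (hg : Continuous g) (hG : Continuous G)
    (hg0 : ∀ x, 0 ≤ g x) (hgG : ∀ x, g x ≤ G x)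
    (hGfin : ∫⁻ x, ENNReal.ofReal (G x) ∂(ν : Measure (EuclideanSpace ℝ (Fin d))) ≠ ∞)
    (hGlim : Tendsto (fun n => ∫⁻ x, ENNReal.ofReal (G x)
      ∂(νs n : Measure (EuclideanSpace ℝ (Fin d)))) atTop
      (𝓝 (∫⁻ x, ENNReal.ofReal (G x) ∂(ν : Measure (EuclideanSpace ℝ (Fin d)))))) :
    Tendsto (fun n => ∫⁻ x, ENNReal.ofReal (g x) ∂(νs n : Measure (EuclideanSpace ℝ (Fin d))))
      atTop (𝓝 (∫⁻ x, ENNReal.ofReal (g x) ∂(ν : Measure (EuclideanSpace ℝ (Fin d))))) := by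
  have hsplit : ∀ μ : Measure (EuclideanSpace ℝ (Fin d)), ∫⁻ x, ENNReal.ofReal (G x) ∂μ =
      ∫⁻ x, ENNReal.ofReal (g x) ∂μ + ∫⁻ x, ENNReal.ofReal (G x - g x) ∂μ := fun μ => by
    rw [← lintegral_add_left (by fun_prop)]
    refine lintegral_congr fun x => ?_
    rw [← ENNReal.ofReal_add (hg0 x) (sub_nonneg.2 (hgG x)), add_sub_cancel]
  have hb := lintegral_le_liminf_lintegral hlim (hG.sub hg) fun x => sub_nonneg.2 (hgG x)
  refine tendsto_of_le_liminf_of_limsup_le (lintegral_le_liminf_lintegral hlim hg hg0) ?_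
  simp only [hsplit] at hGfin hGlim
  set a := ∫⁻ x, ENNReal.ofReal (g x) ∂(ν : Measure (EuclideanSpace ℝ (Fin d)))
  set b := ∫⁻ x, ENNReal.ofReal (G x - g x) ∂(ν : Measure (EuclideanSpace ℝ (Fin d)))
  have hbt : b ≠ ∞ := (ENNReal.add_ne_top.1 hGfin).2
  refine ENNReal.le_of_forall_pos_le_add fun ε hε _ => ?_
  have hε2 : (ε : ℝ≥0∞) / 2 ≠ 0 := (ENNReal.half_pos (by exact_mod_cast hε.ne')).ne'
  have h1 := hGlim.eventually_lt_const (ENNReal.lt_add_right hGfin hε2)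
  have h2 : ∀ᶠ n in atTop, b ≤ ∫⁻ x, ENNReal.ofReal (G x - g x)
      ∂(νs n : Measure (EuclideanSpace ℝ (Fin d))) + ε / 2 := by
    -- For `b = 0` truncated subtraction gives no strict inequality `b - ε / 2 < b`.
    rcases eq_or_ne b 0 with hb0 | hb0
    · simp [hb0]
    · filter_upwards [eventually_lt_of_lt_liminf
        ((ENNReal.sub_lt_self hbt hb0 hε2).trans_le hb)] with n hn
      exact tsub_le_iff_right.1 hn.le
  refine limsup_le_of_le (by isBoundedDefault) ?_
  filter_upwards [h1, h2] with n hn1 hn2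
  refine (ENNReal.add_le_add_iff_right hbt).1 ?_
  calc _ ≤ _ := add_le_add le_rfl hn2
    _ ≤ a + b + ε / 2 + ε / 2 := by
        rw [← add_assoc]
        exact add_le_add hn1.le le_rfl
    _ = a + ε + b := by rw [add_assoc, ENNReal.add_halves, add_right_comm]

/-- The nonnegative case applies to `G + g`, which lies between `0` and `2G`; then the integral of
`G` is subtracted. -/
theorem tendsto_integral_of_abs_le_of_tendsto (hlim : Tendsto νs atTop (𝓝 ν))
    {g G : EuclideanSpace ℝ (Fin d) → ℝ} (hg : Continuous g) (hG : Continuous G)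
    (hgG : ∀ x, |g x| ≤ G x) (hGint : Integrable G (ν : Measure (EuclideanSpace ℝ (Fin d))))
    (hGints : ∀ n, Integrable G (νs n : Measure (EuclideanSpace ℝ (Fin d))))
    (hGlim : Tendsto (fun n => ∫⁻ x, ENNReal.ofReal (G x)
      ∂(νs n : Measure (EuclideanSpace ℝ (Fin d)))) atTop
      (𝓝 (∫⁻ x, ENNReal.ofReal (G x) ∂(ν : Measure (EuclideanSpace ℝ (Fin d)))))) :
    Tendsto (fun n => ∫ x, g x ∂(νs n : Measure (EuclideanSpace ℝ (Fin d)))) atTop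
      (𝓝 (∫ x, g x ∂(ν : Measure (EuclideanSpace ℝ (Fin d))))) := by
  have hG0 : ∀ x, 0 ≤ G x := fun x => (abs_nonneg _).trans (hgG x)
  have hsum0 : ∀ x, 0 ≤ G x + g x := fun x => by linarith [neg_le_of_abs_le (hgG x)]
  have hdbl : ∀ μ : Measure (EuclideanSpace ℝ (Fin d)),
      ∫⁻ x, ENNReal.ofReal (2 * G x) ∂μ = 2 * ∫⁻ x, ENNReal.ofReal (G x) ∂μ := fun μ => by
    rw [← lintegral_const_mul' _ _ (by simp)]
    simp [ENNReal.ofReal_mul]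
  have hfin : ∫⁻ x, ENNReal.ofReal (G x) ∂(ν : Measure (EuclideanSpace ℝ (Fin d))) ≠ ∞ :=
    hGint.lintegral_lt_top.ne
  have key := tendsto_lintegral_of_le_of_tendsto hlim (g := fun x => G x + g x)
    (G := fun x => 2 * G x) (by fun_prop) (by fun_prop) hsum0
    (fun x => by linarith [le_of_abs_le (hgG x)])
    (by rw [hdbl]; finiteness)
    (by
      simp only [hdbl]
      exact ENNReal.Tendsto.const_mul hGlim (Or.inr (by simp)))
  have hgi : ∀ μ : Measure (EuclideanSpace ℝ (Fin d)), Integrable G μ → Integrable g μ :=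
    fun μ hμ => hμ.mono' hg.aestronglyMeasurable (ae_of_all _ hgG)
  have hform : ∀ μ : Measure (EuclideanSpace ℝ (Fin d)), Integrable G μ →
      ∫ x, g x ∂μ = (∫⁻ x, ENNReal.ofReal (G x + g x) ∂μ).toReal -
        (∫⁻ x, ENNReal.ofReal (G x) ∂μ).toReal := by
    intro μ hμ
    rw [← integral_eq_lintegral_of_nonneg_ae (ae_of_all _ hsum0)
      (hG.add hg).aestronglyMeasurable, ← integral_eq_lintegral_of_nonneg_ae (ae_of_all _ hG0)
      hG.aestronglyMeasurable, integral_add hμ (hgi μ hμ), add_sub_cancel_left]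
  rw [hform _ hGint]
  simp only [fun n => hform _ (hGints n)]
  exact ((ENNReal.tendsto_toReal
    (hGint.add (hgi _ hGint)).lintegral_lt_top.ne).comp key).sub
      ((ENNReal.tendsto_toReal hfin).comp hGlim)

/-- A sum of exponentials of linear functions that dominates all quadratic functions. -/
noncomputable def expDominator (ε : ℝ) (x : EuclideanSpace ℝ (Fin d)) : ℝ :=
  1 + ∑ i, (ε ^ 2)⁻¹ * (Real.exp (inner ℝ (EuclideanSpace.single i ε) x) +
    Real.exp (inner ℝ (EuclideanSpace.single i (-ε)) x))

theorem continuous_expDominator (ε : ℝ) : Continuous (expDominator (d := d) ε) := by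
  unfold expDominator
  fun_prop

theorem sq_le_exp_add_exp_neg (t : ℝ) : t ^ 2 ≤ Real.exp t + Real.exp (-t) := by
  wlog ht : 0 ≤ t generalizing t
  · have := this (-t) (by linarith)
    rwa [neg_sq, neg_neg, add_comm] at this
  have h1 := Real.quadratic_le_exp_of_nonneg ht
  have h2 := Real.sum_le_exp_of_nonneg ht 4
  have h3 := Real.exp_pos (-t)
  simp only [Finset.sum_range_succ, Finset.sum_range_zero, Nat.factorial] at h2
  norm_num at h2
  nlinarith [sq_nonneg (t - 2), mul_nonneg ht (sq_nonneg (t - 3 / 2)), sq_nonneg (t - 1)]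

theorem norm_sq_add_one_le_expDominator {ε : ℝ} (hε : 0 < ε) (x : EuclideanSpace ℝ (Fin d)) :
    1 + ‖x‖ ^ 2 ≤ expDominator ε x := by
  rw [EuclideanSpace.norm_sq_eq, expDominator]
  gcongr with i
  rw [EuclideanSpace.inner_single_left, EuclideanSpace.inner_single_left, le_inv_mul_iff₀
    (by positivity)]
  have := sq_le_exp_add_exp_neg (ε * x i)
  simpa [mul_pow] using this

theorem lintegral_expDominator (ε : ℝ) (μ : Measure (EuclideanSpace ℝ (Fin d)))
    [IsProbabilityMeasure μ] :
    ∫⁻ x, ENNReal.ofReal (expDominator ε x) ∂μ = 1 + ∑ i, ENNReal.ofReal (ε ^ 2)⁻¹ *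
      (expMoment μ (EuclideanSpace.single i ε) + expMoment μ (EuclideanSpace.single i (-ε))) := by
  have h : ∀ x : EuclideanSpace ℝ (Fin d), ENNReal.ofReal (expDominator ε x) =
      1 + ∑ i, ENNReal.ofReal (ε ^ 2)⁻¹ *
        (ENNReal.ofReal (Real.exp (inner ℝ (EuclideanSpace.single i ε) x)) +
          ENNReal.ofReal (Real.exp (inner ℝ (EuclideanSpace.single i (-ε)) x))) := by
    intro x
    rw [expDominator, ENNReal.ofReal_add zero_le_one (Finset.sum_nonneg fun i _ => by positivity),
      ENNReal.ofReal_one, ENNReal.ofReal_sum_of_nonneg fun i _ => by positivity]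
    congr 1
    refine Finset.sum_congr rfl fun i _ => ?_
    rw [ENNReal.ofReal_mul (by positivity),
      ENNReal.ofReal_add (Real.exp_nonneg _) (Real.exp_nonneg _)]
  have hm := measurable_ofReal_exp_inner (d := d)
  simp only [h]
  rw [lintegral_add_left measurable_const, lintegral_const, measure_univ, mul_one,
    lintegral_finsetSum _ fun i _ => by fun_prop]
  congr 1
  refine Finset.sum_congr rfl fun i _ => ?_
  rw [lintegral_const_mul' _ _ ENNReal.ofReal_ne_top, lintegral_add_left (hm _), expMoment, expMoment]

theorem exists_forall_single_mem {S : Set (EuclideanSpace ℝ (Fin d))} (hS : IsOpen S)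
    (h0 : 0 ∈ S) :
    ∃ ε > 0, ∀ i, EuclideanSpace.single i ε ∈ S ∧ EuclideanSpace.single i (-ε) ∈ S := by
  obtain ⟨ρ, hρ, hball⟩ := Metric.isOpen_iff.1 hS 0 h0
  refine ⟨ρ / 2, half_pos hρ, fun i => ⟨hball ?_, hball ?_⟩⟩ <;>
  · rw [mem_ball_zero_iff, PiLp.norm_single]
    simp [abs_of_pos hρ, hρ]

theorem integrable_expDominator {ε : ℝ} (hε : 0 < ε) {μ : Measure (EuclideanSpace ℝ (Fin d))}
    [IsProbabilityMeasure μ] (h : ∀ i, EuclideanSpace.single i ε ∈ expMomentDomain μ ∧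
      EuclideanSpace.single i (-ε) ∈ expMomentDomain μ) :
    Integrable (expDominator ε) μ := by
  have hnn : ∀ x : EuclideanSpace ℝ (Fin d), 0 ≤ expDominator ε x := fun x =>
    (by positivity : (0 : ℝ) ≤ 1 + ‖x‖ ^ 2).trans (norm_sq_add_one_le_expDominator hε x)
  refine ⟨(continuous_expDominator ε).aestronglyMeasurable, ?_⟩
  rw [hasFiniteIntegral_iff_ofReal (ae_of_all _ hnn), lintegral_expDominator]
  refine ENNReal.add_lt_top.2 ⟨by simp, ENNReal.sum_lt_top.2 fun i _ => ?_⟩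
  exact ENNReal.mul_lt_top ENNReal.ofReal_lt_top (ENNReal.add_lt_top.2 (h i))

theorem memLp_id_of_isOpen_expMomentDomain {μ : Measure (EuclideanSpace ℝ (Fin d))}
    [IsProbabilityMeasure μ] (h : IsOpen (expMomentDomain μ)) : MemLp id 2 μ := by
  obtain ⟨ε, hε, hmem⟩ := exists_forall_single_mem h (zero_mem_expMomentDomain μ)
  rw [memLp_two_iff_integrable_sq_norm continuous_id.aestronglyMeasurable]
  refine (integrable_expDominator hε hmem).mono' (by fun_prop) (ae_of_all _ fun x => ?_)
  rw [Real.norm_of_nonneg (by positivity)]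
  rw [id]
  linarith [norm_sq_add_one_le_expDominator hε x]

theorem memLp_coord {μ : Measure (EuclideanSpace ℝ (Fin d))} (h : MemLp id 2 μ) (i : Fin d) :
    MemLp (fun x : EuclideanSpace ℝ (Fin d) => x i) 2 μ :=
  h.mono (by fun_prop) (ae_of_all _ fun x => PiLp.norm_apply_le x i)

theorem tendsto_covMatrix (hlim : Tendsto νs atTop (𝓝 ν))
    (hmid : ∀ n θ, IsMidpointLogConcave
      (expTilt (νs n : Measure (EuclideanSpace ℝ (Fin d))) θ)) :
    Tendsto (fun n => covMatrix (νs n : Measure (EuclideanSpace ℝ (Fin d)))) atTop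
      (𝓝 (covMatrix (ν : Measure (EuclideanSpace ℝ (Fin d))))) := by
  have hopen := isOpen_expMomentDomain hlim hmid
  have hopens : ∀ n, IsOpen (expMomentDomain (νs n : Measure (EuclideanSpace ℝ (Fin d)))) :=
    -- Each `νs n` is the weak limit of its own constant sequence.
    fun n => isOpen_expMomentDomain (νs := fun _ => νs n) tendsto_const_nhds fun _ => hmid n
  obtain ⟨ε, hε, hmem⟩ := exists_forall_single_mem hopen (zero_mem_expMomentDomain _)
  have hcont := fun θ hθ => tendsto_expMoment hlim (fun n => hmid n θ) hθ
  have hGlim : Tendsto (fun n => ∫⁻ x, ENNReal.ofReal (expDominator ε x)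
      ∂(νs n : Measure (EuclideanSpace ℝ (Fin d)))) atTop
      (𝓝 (∫⁻ x, ENNReal.ofReal (expDominator ε x)
        ∂(ν : Measure (EuclideanSpace ℝ (Fin d))))) := by
    simp only [lintegral_expDominator]
    exact tendsto_const_nhds.add (tendsto_finsetSum _ fun i _ =>
      ENNReal.Tendsto.const_mul ((hcont _ (hmem i).1).add (hcont _ (hmem i).2))
        (Or.inr ENNReal.ofReal_ne_top))
  have hGint := integrable_expDominator hε hmem
  obtain ⟨N, hN⟩ : ∃ N, ∀ n ≥ N,
      Integrable (expDominator ε) (νs n : Measure (EuclideanSpace ℝ (Fin d))) := by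
    have h1 : ∀ i, ∀ᶠ n in atTop,
        EuclideanSpace.single i ε ∈ expMomentDomain (νs n : Measure (EuclideanSpace ℝ (Fin d))) ∧
        EuclideanSpace.single i (-ε) ∈
          expMomentDomain (νs n : Measure (EuclideanSpace ℝ (Fin d))) := fun i =>
      ((hcont _ (hmem i).1).eventually_lt_const (hmem i).1).and
        ((hcont _ (hmem i).2).eventually_lt_const (hmem i).2)
    obtain ⟨N, hN⟩ := eventually_atTop.1 (eventually_all.2 h1)
    exact ⟨N, fun n hn => integrable_expDominator hε (hN n hn)⟩
  have hint : ∀ g : EuclideanSpace ℝ (Fin d) → ℝ, Continuous g →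
      (∀ x, |g x| ≤ 1 + ‖x‖ ^ 2) →
      Tendsto (fun n => ∫ x, g x ∂(νs n : Measure (EuclideanSpace ℝ (Fin d)))) atTop
        (𝓝 (∫ x, g x ∂(ν : Measure (EuclideanSpace ℝ (Fin d))))) := fun g hg hgle => by
    -- The `ε` comes from the domain of `ν`; for small `n` the dominating function may fail to be
    -- integrable, so the sequence is shifted by `N`.
    rw [← tendsto_add_atTop_iff_nat N]
    rw [← tendsto_add_atTop_iff_nat N] at hGlim
    exact tendsto_integral_of_abs_le_of_tendsto ((tendsto_add_atTop_iff_nat N).2 hlim) hg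
      (continuous_expDominator ε)
      (fun x => (hgle x).trans (norm_sq_add_one_le_expDominator hε x)) hGint
      (fun n => hN _ (Nat.le_add_left N n)) hGlim
  have hcoord : ∀ (x : EuclideanSpace ℝ (Fin d)) i, |x i| ≤ ‖x‖ := fun x i =>
    PiLp.norm_apply_le x i
  refine tendsto_pi_nhds.2 fun i => tendsto_pi_nhds.2 fun j => ?_
  have hcov : ∀ μ : Measure (EuclideanSpace ℝ (Fin d)), IsProbabilityMeasure μ → MemLp id 2 μ →
      covMatrix μ i j = ∫ x, x i * x j ∂μ - (∫ x, x i ∂μ) * ∫ x, x j ∂μ := fun μ _ h => by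
    rw [covMatrix, Matrix.of_apply, covariance_eq_sub (memLp_coord h i) (memLp_coord h j)]
    rfl
  rw [hcov _ inferInstance (memLp_id_of_isOpen_expMomentDomain hopen)]
  simp only [fun n => hcov _ inferInstance (memLp_id_of_isOpen_expMomentDomain (hopens n))]
  have hlin : ∀ (x : EuclideanSpace ℝ (Fin d)) k, |x k| ≤ 1 + ‖x‖ ^ 2 := fun x k => by
    nlinarith [hcoord x k, sq_nonneg (‖x‖ - 1)]
  refine (hint _ (by fun_prop) fun x => ?_).sub
    ((hint _ (by fun_prop) fun x => hlin x i).mul (hint _ (by fun_prop) fun x => hlin x j))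
  rw [abs_mul]
  nlinarith [mul_le_mul (hcoord x i) (hcoord x j) (abs_nonneg _) (norm_nonneg x)]

end Moments

theorem proposition3p3 (d : ℕ)
    (f : ℕ → EuclideanSpace ℝ (Fin d) → ℝ)
    (hf : ∀ n, IsLogConcaveDensity (f n))
    (νs : ℕ → ProbabilityMeasure (EuclideanSpace ℝ (Fin d)))
    (hνs : ∀ n, (νs n : Measure (EuclideanSpace ℝ (Fin d))) =
      volume.withDensity fun x => ENNReal.ofReal (f n x))
    (ν : ProbabilityMeasure (EuclideanSpace ℝ (Fin d)))
    (hlim : Tendsto νs atTop (𝓝 ν)) :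
    (∃ Θ₀ : Set (supportDirection (ν : Measure (EuclideanSpace ℝ (Fin d)))),
      IsOpen Θ₀ ∧ Convex ℝ Θ₀ ∧ 0 ∈ Θ₀ ∧
      expMomentDomain (ν : Measure (EuclideanSpace ℝ (Fin d))) =
        ((↑) '' Θ₀ : Set (EuclideanSpace ℝ (Fin d))) +
          ((supportDirection (ν : Measure (EuclideanSpace ℝ (Fin d))))ᗮ :
            Set (EuclideanSpace ℝ (Fin d)))) ∧
    (∀ θ ∈ expMomentDomain (ν : Measure (EuclideanSpace ℝ (Fin d))),
      Tendsto (fun n => expMoment (νs n : Measure (EuclideanSpace ℝ (Fin d))) θ) atTop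
        (𝓝 (expMoment (ν : Measure (EuclideanSpace ℝ (Fin d))) θ))) ∧
    (∀ n, MemLp id 2 (νs n : Measure (EuclideanSpace ℝ (Fin d)))) ∧
    MemLp id 2 (ν : Measure (EuclideanSpace ℝ (Fin d))) ∧
    Tendsto (fun n => covMatrix (νs n : Measure (EuclideanSpace ℝ (Fin d)))) atTop
      (𝓝 (covMatrix (ν : Measure (EuclideanSpace ℝ (Fin d))))) := by
  have hmid : ∀ n θ, IsMidpointLogConcave
      (expTilt (νs n : Measure (EuclideanSpace ℝ (Fin d))) θ) := fun n θ => by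
    rw [hνs n]
    exact (hf n).isMidpointLogConcave_expTilt θ
  have hopen := isOpen_expMomentDomain hlim hmid
  exact ⟨exists_expMomentDomain_eq_add _ hopen,
    fun θ hθ => tendsto_expMoment hlim (fun n => hmid n θ) hθ,
    fun n => memLp_id_of_isOpen_expMomentDomain
      (isOpen_expMomentDomain (νs := fun _ => νs n) tendsto_const_nhds fun _ => hmid n),
    memLp_id_of_isOpen_expMomentDomain hopen, tendsto_covMatrix hlim hmid⟩
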